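/- **Virtually free presentations.** A virtually free presentation $\mathcal V$ consists of finite pairwise disjoint sets $X$, $\overline X=\{\bar x : x\in X\}$ (formal inverses, $\bar{\bar x}=x$) and $S$, where $S$ has a distinguished element $1$ that is identified with the empty word, together with words $x_{r,a}\in (X\cup\overline X)^*$ and elements $s_{r,a}\in S$ for all $r\in S\setminus\{1\}$ and $a\in X\cup\overline X\cup (S\setminus\{1\})$, such that 1. for every $r\in S\setminus\{1\}$ there is $r'\in S\setminus\{1\}$ with $s_{r',r}=1$; 2. the rewriting system over $X\cup\overline X\cup(S\setminus\{1\})$ with the rules $ra\to x_{r,a}s_{r,a}$ and $y\bar y\to 1$ for $y\in X\cup\overline X$ is confluent. The group $G$ defined by $\mathcal V$ is the group generated by $X\cup (S\setminus\{1\})$ with defining relations $ra=x_{r,a}s_{r,a}$, where $\bar x=x^{-1}$. Put $x_{1,y}=y$ for $y\in X\cup\overline X$, and let $x_{1,t}$ and $x_{r,1}$ be empty for $r,t\in S$. The size of $\mathcal V$ is $$\|\mathcal V\| = |S|\,(2|X|+2|S|)\cdot\max\{\,|x_{r,a}|+1 : r\in S,\ a\in X\cup\overline X\cup S\,\}.$$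 Let $\Sigma=X\sqcup\overline X\sqcup S\sqcup\overline S$, where $\overline S$ is a disjoint copy of formal inverses of $S$. The Cayley graph $\Gamma$ of $G$ has vertex set $G$ and edge set $G\times\Sigma$; the edge $(g,a)$ leads from $g$ to $ga$, and its opposite edge is $(ga,\bar a)$. **Cuts.** For a set $C$ of vertices of $\Gamma$ let $\vec\delta C$ be the set of edges leading from $C$ to its complement $\overline C$. A cut is a set $C$ such that $C$ and $\overline C$ are both non-empty and connected (that is, induce connected subgraphs) and $\vec\delta C$ is finite; its weight is $|\vec\delta C|$, and it is a $K$-cut if its weight is at most $K$. A cut $C$ splits a bi-infinite simple path $\alpha$ (a bi-infinite path with pairwise distinct vertices) if infinitely many vertices of $\alpha$ lie in $C$ and infinitely many lie in $\overline C$. A cut is minimal if, for some bi-infinite simple path $\alpha$, it splits $\alpha$ and has minimal weight among all cuts splitting $\alpha$. **Lemma.** Let $G$ be the group defined by a virtually free presentation $\mathcal V$ and let $\Gamma$ be its Cayley graph. Then every minimal cut in $\Gamma$ is a $K$-cut for $K=\|\mathcal V\|^2$. -/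

import Mathlib

universe u v

/-! # Undirected graphs with oriented edges, cuts, minimal cuts -/

/-- An undirected graph with vertex set `V` and set of oriented edges `E`: every edge has a source,
a target and an opposite edge, and the involution on edges has no fixed points. Loops and parallel
edges are allowed. -/
structure InvGraph (V : Type u) (E : Type v) where
  src : E → V
  tgt : E → V
  inv : E → E
  inv_inv : ∀ e, inv (inv e) = e
  inv_ne : ∀ e, inv e ≠ e
  src_inv : ∀ e, src (inv e) = tgt e

namespace InvGraph

variable {V : Type u} {E : Type v} (Γ : InvGraph V E)

/-- The subgraph induced by the vertex set `C` is connected: any two vertices of `C` are joined by a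
finite path all of whose vertices lie in `C`. -/
def ConnectedOn (C : Set V) : Prop :=
  ∀ ⦃u⦄, u ∈ C → ∀ ⦃w⦄, w ∈ C →
    Relation.ReflTransGen
      (fun a b => a ∈ C ∧ b ∈ C ∧ ∃ e : E, Γ.src e = a ∧ Γ.tgt e = b) u w

/-- The directed edge boundary of `C`: the edges leading from `C` to its complement. -/
def dirBoundary (C : Set V) : Set E :=
  {e | Γ.src e ∈ C ∧ Γ.tgt e ∈ Cᶜ}

/-- A cut: `C` and its complement are non-empty and connected, and the boundary is finite. -/
structure IsCut (C : Set V) : Prop where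
  nonempty : C.Nonempty
  compl_nonempty : (Cᶜ).Nonempty
  connected : Γ.ConnectedOn C
  compl_connected : Γ.ConnectedOn Cᶜ
  finite_boundary : (Γ.dirBoundary C).Finite

/-- The weight of a cut: the number of edges leading from `C` to its complement, which is the number
of undirected edges between `C` and its complement. -/
noncomputable def weight (C : Set V) : ℕ :=
  (Γ.dirBoundary C).ncard

/-- A `k`-cut is a cut of weight at most `k`. -/
def IsKCut (k : ℕ) (C : Set V) : Prop :=
  Γ.IsCut C ∧ Γ.weight C ≤ k

/-- A bi-infinite simple path: the `i`-th edge leads from the vertex `i - 1` to the vertex `i`, and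
the vertices are pairwise distinct. -/
structure BiInfSimplePath where
  vert : ℤ → V
  edge : ℤ → E
  src_edge : ∀ i, Γ.src (edge i) = vert (i - 1)
  tgt_edge : ∀ i, Γ.tgt (edge i) = vert i
  simple : Function.Injective vert

variable {Γ}

/-- The cut `C` splits the path `α`: infinitely many vertices of `α` lie in `C` and infinitely many
lie outside `C`. -/
def BiInfSimplePath.SplitBy (α : Γ.BiInfSimplePath) (C : Set V) : Prop :=
  Γ.IsCut C ∧ (Set.range α.vert ∩ C).Infinite ∧ (Set.range α.vert ∩ Cᶜ).Infinite

/-- `C` has minimal weight among all the cuts splitting `α`. -/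
def BiInfSimplePath.MinSplitBy (α : Γ.BiInfSimplePath) (C : Set V) : Prop :=
  α.SplitBy C ∧ ∀ D : Set V, α.SplitBy D → Γ.weight C ≤ Γ.weight D

variable (Γ)

/-- The minimal cuts: those of minimal weight among the cuts splitting some bi-infinite simple
path. -/
def IsMinimalCut (C : Set V) : Prop :=
  ∃ α : Γ.BiInfSimplePath, α.MinSplitBy C

end InvGraph

/-- The Cayley graph of a group `G` with respect to the symmetric alphabet consisting of letters
`(z, true)`, standing for the elements `val z`, and their formal inverses `(z, false)`: the vertices
are the elements of `G`, the edges are the pairs `(g, a)` with `a` a letter, and `(g, a)` leads from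
`g` to `g a`. -/
def cayleyInvGraph {Z : Type u} {G : Type v} [Group G] (val : Z → G) :
    InvGraph G (G × (Z × Bool)) where
  src e := e.1
  tgt e := e.1 * cond e.2.2 (val e.2.1) (val e.2.1)⁻¹
  inv e := (e.1 * cond e.2.2 (val e.2.1) (val e.2.1)⁻¹, (e.2.1, !e.2.2))
  inv_inv := by rintro ⟨g, z, _ | _⟩ <;> simp
  inv_ne := by rintro ⟨g, z, _ | _⟩ <;> simp
  src_inv _ := rfl

/-! # Virtually free presentations -/

/-- The data of a virtually free presentation. The symmetric alphabet `X ∪ X̄` is `X × Bool`, the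
letter `x` being `(x, true)` and its formal inverse `(x, false)`. The set `S` is `Option T`, with
distinguished element `1 = none`, so that `T` is `S \ {1}`. For `r` in `S \ {1}` and a letter `a` in
`X ∪ X̄ ∪ S \ {1}` there are a word `word r a` over `X ∪ X̄` and an element `rep r a` of `S`, which
stand for the relation `r a = word r a · rep r a`. -/
structure VFData (X : Type u) (T : Type v) where
  word : T → (X × Bool) ⊕ T → List (X × Bool)
  rep : T → (X × Bool) ⊕ T → Option T

namespace VFData

variable {X : Type u} {T : Type v} (V : VFData X T)

/-- The right-hand side `word r a · rep r a` as a word over `X ∪ X̄ ∪ S \ {1}`; the element `1` of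
`S` is the empty word. -/
def rhs (r : T) (a : (X × Bool) ⊕ T) : List ((X × Bool) ⊕ T) :=
  (V.word r a).map Sum.inl ++ (V.rep r a).toList.map Sum.inr

/-- One step of the rewriting system: an application of a rule `r a → word r a · rep r a`, or a free
reduction `y ȳ → 1` with `y` in `X ∪ X̄`. -/
inductive Step : List ((X × Bool) ⊕ T) → List ((X × Bool) ⊕ T) → Prop
  | rule (p q : List ((X × Bool) ⊕ T)) (r : T) (a : (X × Bool) ⊕ T) :
      Step (p ++ [Sum.inr r, a] ++ q) (p ++ V.rhs r a ++ q)
  | free (p q : List ((X × Bool) ⊕ T)) (x : X) (b : Bool) :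
      Step (p ++ [Sum.inl (x, b), Sum.inl (x, !b)] ++ q) (p ++ q)

end VFData

/-- A virtually free presentation: every `r` in `S \ {1}` has some `r'` in `S \ {1}` with
`s_{r', r} = 1`, and the rewriting system is confluent. -/
structure VFPresentation (X : Type u) (T : Type v) extends VFData X T where
  exists_inv : ∀ r : T, ∃ r' : T, rep r' (Sum.inr r) = none
  confluent : ∀ w w₁ w₂ : List ((X × Bool) ⊕ T),
    Relation.ReflTransGen toVFData.Step w w₁ → Relation.ReflTransGen toVFData.Step w w₂ →
      Relation.Join (Relation.ReflTransGen toVFData.Step) w₁ w₂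

namespace VFPresentation

variable {X : Type u} {T : Type v} (V : VFPresentation X T)

/-- The element of the free group on `X ∪ S \ {1}` represented by a letter of
`X ∪ X̄ ∪ S \ {1}`. -/
def letterVal : (X × Bool) ⊕ T → FreeGroup (X ⊕ T)
  | Sum.inl (x, b) => cond b (FreeGroup.of (Sum.inl x)) (FreeGroup.of (Sum.inl x))⁻¹
  | Sum.inr t => FreeGroup.of (Sum.inr t)

/-- The relators `r a (word r a · rep r a)⁻¹`. -/
def relators : Set (FreeGroup (X ⊕ T)) :=
  {g | ∃ (r : T) (a : (X × Bool) ⊕ T),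
    g = letterVal (X := X) (Sum.inr r) * letterVal a * (((V.rhs r a).map letterVal).prod)⁻¹}

/-- The group defined by a virtually free presentation. -/
abbrev Grp : Type (max u v) := PresentedGroup V.relators

/-- The values in the group of the generators in `X` and in `S` (with `1` in `S` having value
`1`). -/
def genVal : X ⊕ Option T → V.Grp
  | Sum.inl x => PresentedGroup.of (Sum.inl x)
  | Sum.inr none => 1
  | Sum.inr (some t) => PresentedGroup.of (Sum.inr t)

/-- The Cayley graph of the group with respect to `Σ = X ∪ X̄ ∪ S ∪ S̄`, where `S̄` is a disjoint
copy of formal inverses of `S`. -/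
def cayleyGraph : InvGraph V.Grp (V.Grp × ((X ⊕ Option T) × Bool)) :=
  cayleyInvGraph V.genVal

/-- The words `x_{r, a}` for all `r` in `S` and `a` in `X ∪ X̄ ∪ S`. For `r = 1` or `a = 1` they are
the evident ones: `1 y = y 1`, `1 t = 1 t` and `r 1 = 1 r`. -/
def table : Option T → (X × Bool) ⊕ Option T → List (X × Bool)
  | some r, Sum.inl y => V.word r (Sum.inl y)
  | some r, Sum.inr (some t) => V.word r (Sum.inr t)
  | some _, Sum.inr none => []
  | none, Sum.inl y => [y]
  | none, Sum.inr _ => []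

/-- The size `|S| (2|X| + 2|S|) max {|x_{r, a}| + 1 : r ∈ S, a ∈ X ∪ X̄ ∪ S}`. -/
def size [Fintype X] [Fintype T] : ℕ :=
  Fintype.card (Option T) * (2 * Fintype.card X + 2 * Fintype.card (Option T)) *
    Finset.univ.sup fun p : Option T × ((X × Bool) ⊕ Option T) => (V.table p.1 p.2).length + 1

end VFPresentation

/-! # Normal forms -/

/-! Confluence makes every element of $G$ equal to $us$ for exactly one pair of a reduced word $u$
and $s\in S$. So $G$ is, as a set, $F(X)\times S$, and right multiplication by a generator
multiplies the free part by one of the words $x_{r,a}$. The Cayley graph thus follows the tree of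
$F(X)$ up to bounded detours.

The cone of $w$ consists of the elements whose free part begins with $w$. In the tree a cone can be
entered or left only through $w$, so an edge of $\Gamma$ crossing its boundary has a word $x_{r,a}$
whose reading passes through $w$. Such an edge is determined by the $S$-part of one end, its label
and a prefix length, which leaves at most $\|\mathcal V\|$ edges (`weight_grpCone_le`).

Let a cut $C$ split $\alpha$. One end of $\alpha$ stays in $C$ and the other outside. For each $n$,
each end finally stays in the cone of some word of length $n$. If both ends chose the same $w$ for
large $n$, both would pass close to $w$, far from the finite boundary of $C$, and so lie on the same
side of $C$. Hence the two cones are disjoint, and one of them separates the ends. Passing to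
components turns it into a cut without raising the weight (`exists_isCut_weight_le`). A minimal cut
therefore has weight at most $\|\mathcal V\|$, which is stronger than the square. -/

namespace VFData

variable {X : Type u} {T : Type v} (V : VFData X T)

/-- The right action of the letters on normal forms: `(u, s)` stands for the normal form `u s` with
`u` a reduced word over `X ∪ X̄` and `s` in `S`. -/
def act : FreeGroup X × Option T → (X × Bool) ⊕ T → FreeGroup X × Option T
  | (u, none), Sum.inl y => (u * FreeGroup.mk [y], none)
  | (u, none), Sum.inr t => (u, some t)
  | (u, some r), a => (u * FreeGroup.mk (V.word r a), V.rep r a)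

/-- The irreducible word representing a normal form. -/
def nf [DecidableEq X] (p : FreeGroup X × Option T) : List ((X × Bool) ⊕ T) :=
  p.1.toWord.map Sum.inl ++ p.2.toList.map Sum.inr

variable {V}

theorem Step.append_left {w w' : List ((X × Bool) ⊕ T)} (h : V.Step w w')
    (l : List ((X × Bool) ⊕ T)) : V.Step (l ++ w) (l ++ w') := by
  cases h with
  | rule p q r a => simpa using Step.rule (V := V) (l ++ p) q r a
  | free p q x b => simpa using Step.free (V := V) (l ++ p) q x b

theorem Step.append_right {w w' : List ((X × Bool) ⊕ T)} (h : V.Step w w')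
    (l : List ((X × Bool) ⊕ T)) : V.Step (w ++ l) (w' ++ l) := by
  cases h with
  | rule p q r a => simpa using Step.rule (V := V) p (q ++ l) r a
  | free p q x b => simpa using Step.free (V := V) p (q ++ l) x b

theorem steps_of_red {L L' : List (X × Bool)} (h : FreeGroup.Red L L')
    (l : List ((X × Bool) ⊕ T)) :
    Relation.ReflTransGen V.Step (L.map Sum.inl ++ l) (L'.map Sum.inl ++ l) := by
  induction h with
  | refl => exact .refl
  | tail _ h ih =>
    refine ih.tail ?_
    cases h with
    | @not L₁ L₂ x b => simpa using Step.free (V := V) (L₁.map Sum.inl) (L₂.map Sum.inl ++ l) x b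

variable (V)

theorem nf_injective [DecidableEq X] :
    Function.Injective (nf : FreeGroup X × Option T → List ((X × Bool) ⊕ T)) := by
  rintro ⟨u, s⟩ ⟨u', s'⟩ h
  have h1 := congrArg (List.filterMap (Sum.elim some (fun _ => none))) h
  have h2 := congrArg (List.filterMap (Sum.elim (fun _ => none) some)) h
  simp only [nf, List.filterMap_append, List.filterMap_map, Function.comp_def, Sum.elim_inl,
    Sum.elim_inr, List.filterMap_some, List.filterMap_none, List.append_nil, List.nil_append,
    FreeGroup.toWord_inj] at h1 h2
  subst h1
  cases s <;> cases s' <;> simp_all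

/-- A rule needs a letter of $S\setminus\{1\}$ followed by another letter, but here such a letter
can only come last. A free cancellation would survive deletion of the $S$-letter and contradict
reducedness of $u$. -/
theorem not_step_nf [DecidableEq X] (p : FreeGroup X × Option T) (w : List ((X × Bool) ⊕ T)) :
    ¬ V.Step (nf p) w := by
  obtain ⟨u, s⟩ := p
  intro h
  generalize hn : nf (u, s) = n at h
  cases h with
  | rule p q r a =>
    rw [nf, List.append_assoc, List.append_eq_append_iff] at hn
    rcases hn with ⟨l, h1, h2⟩ | ⟨l, h1, h2⟩
    · have := congrArg List.length h2
      cases s <;> simp at this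
      omega
    · have hr : ∀ z ∈ l, ∃ y, z = Sum.inl y := fun z hz => by
        have : z ∈ u.toWord.map Sum.inl := by simp_all
        simp only [List.mem_map] at this
        obtain ⟨y, -, rfl⟩ := this
        exact ⟨y, rfl⟩
      cases l with
      | nil =>
        have := congrArg List.length h2
        cases s <;> simp at this
      | cons z l =>
        simp only [List.cons_append, List.nil_append, List.cons.injEq] at h2
        obtain ⟨y, hy⟩ := hr z (by simp)
        simp [← h2.1] at hy
  | free p q x b =>
    have h1 := congrArg (List.filterMap (Sum.elim some (fun _ => none))) hn
    simp only [nf, List.filterMap_append, List.filterMap_map, Function.comp_def, Sum.elim_inl,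
      Sum.elim_inr, List.filterMap_some, List.filterMap_none, List.append_nil] at h1
    refine (FreeGroup.isReduced_toWord (x := u)).not_step (L₂ := ?_) ?_
    · exact p.filterMap (Sum.elim some (fun _ => none)) ++ q.filterMap (Sum.elim some (fun _ => none))
    · rw [h1]
      simp

theorem steps_nf_act [DecidableEq X] (p : FreeGroup X × Option T) (a : (X × Bool) ⊕ T) :
    Relation.ReflTransGen V.Step (nf p ++ [a]) (nf (V.act p a)) := by
  have key (u : FreeGroup X) (L : List (X × Bool)) : FreeGroup.Red (u.toWord ++ L)
      (u * FreeGroup.mk L).toWord := by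
    rw [FreeGroup.toWord_mul, FreeGroup.toWord_mk]
    nth_rw 2 [← FreeGroup.reduce_toWord u]
    rw [FreeGroup.reduce_append_reduce_reduce]
    exact FreeGroup.reduce.red
  rcases p with ⟨u, _ | r⟩
  · rcases a with y | t
    · simpa [nf, act] using steps_of_red (V := V) (key u [y]) []
    · simpa [nf, act] using Relation.ReflTransGen.refl
  · refine .head (b := u.toWord.map Sum.inl ++ V.rhs r a) ?_ ?_
    · simpa [nf] using Step.rule (V := V) (u.toWord.map Sum.inl) [] r a
    · simpa [nf, act, rhs] using
        steps_of_red (V := V) (key u (V.word r a)) ((V.rep r a).toList.map Sum.inr)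

theorem steps_nf_foldl [DecidableEq X] (w : List ((X × Bool) ⊕ T)) (p : FreeGroup X × Option T) :
    Relation.ReflTransGen V.Step (nf p ++ w) (nf (w.foldl V.act p)) := by
  induction w generalizing p with
  | nil => simpa using Relation.ReflTransGen.refl
  | cons a w ih =>
    refine Relation.ReflTransGen.trans ?_ (ih (V.act p a))
    have : Relation.ReflTransGen V.Step (nf p ++ [a] ++ w) (nf (V.act p a) ++ w) :=
      (V.steps_nf_act p a).lift (· ++ w) fun _ _ h => h.append_right w
    simpa using this

end VFData

/-! ### The group acts on normal forms, and is thereby identified with $F(X)\times S$ -/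

namespace VFPresentation

variable {X : Type u} {T : Type v} (V : VFPresentation X T)

/-- The word `nf p ++ w` rewrites to both resulting normal forms, to one of them through `nf p ++
w'`. Both are irreducible, so confluence forces them to coincide. Termination of the system is not
needed, since the reductions to normal form are explicit. -/
theorem foldl_act_eq_of_step {w w' : List ((X × Bool) ⊕ T)} (h : V.Step w w')
    (p : FreeGroup X × Option T) : w.foldl V.act p = w'.foldl V.act p := by
  classical
  have eq_of_steps {q : FreeGroup X × Option T} {l : List ((X × Bool) ⊕ T)}
      (h : Relation.ReflTransGen V.Step (VFData.nf q) l) : l = VFData.nf q := by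
    rcases Relation.ReflTransGen.cases_head h with h | ⟨c, h, -⟩
    · exact h.symm
    · exact absurd h (V.not_step_nf q c)
  obtain ⟨c, h1, h2⟩ := V.confluent (VFData.nf p ++ w) _ _ (V.steps_nf_foldl w p)
    (.head (h.append_left _) (V.steps_nf_foldl w' p))
  exact VFData.nf_injective ((eq_of_steps h1).symm.trans (eq_of_steps h2))

theorem act_act_not (p : FreeGroup X × Option T) (x : X) (b : Bool) :
    V.act (V.act p (Sum.inl (x, b))) (Sum.inl (x, !b)) = p := by
  simpa using V.foldl_act_eq_of_step (VFData.Step.free [] [] x b) p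

theorem act_inl_bijective (y : X × Bool) : Function.Bijective (V.act · (Sum.inl y)) := by
  obtain ⟨x, b⟩ := y
  refine Function.bijective_iff_has_inverse.2 ⟨(V.act · (Sum.inl (x, !b))), fun p => ?_, fun p => ?_⟩
  · exact V.act_act_not p x b
  · simpa using V.act_act_not p x (!b)

theorem foldl_act_inl_bijective (w : List (X × Bool)) :
    Function.Bijective fun p => (w.map Sum.inl).foldl V.act p := by
  induction w with
  | nil => exact Function.bijective_id
  | cons y w ih => exact ih.comp (V.act_inl_bijective y)

/-- If $s_{r',r}=1$, then acting by $r'$ and then $r$ is acting by a word over $X\cup\overline X$,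
hence bijective. This makes $r$ surjective and $r'$ injective. The same argument for $r'$ and its
own $r''$ makes $r'$ surjective, whence $r$ is injective. -/
theorem act_inr_bijective (r : T) : Function.Bijective (V.act · (Sum.inr r)) := by
  have key {r' r : T} (h : V.rep r' (Sum.inr r) = none) :
      Function.Bijective ((V.act · (Sum.inr r)) ∘ (V.act · (Sum.inr r'))) := by
    convert V.foldl_act_inl_bijective (V.word r' (Sum.inr r)) using 2 with p
    simpa [VFData.rhs, h] using V.foldl_act_eq_of_step (VFData.Step.rule [] [] r' (Sum.inr r)) p
  obtain ⟨r', h⟩ := V.exists_inv r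
  obtain ⟨r'', h'⟩ := V.exists_inv r'
  exact ⟨(key h).1.of_comp_right (key h').2.of_comp, (key h).2.of_comp⟩

/-- The permutation of the normal forms given by a generator. -/
noncomputable def genPerm : X ⊕ T → (Equiv.Perm (FreeGroup X × Option T))ᵐᵒᵖ
  | Sum.inl x => .op (Equiv.ofBijective _ (V.act_inl_bijective (x, true)))
  | Sum.inr t => .op (Equiv.ofBijective _ (V.act_inr_bijective t))

theorem lift_genPerm_letterVal (a : (X × Bool) ⊕ T) (p : FreeGroup X × Option T) :
    (FreeGroup.lift V.genPerm (letterVal a)).unop p = V.act p a := by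
  rcases a with ⟨x, _ | _⟩ | t
  · simp only [letterVal, cond_false, map_inv, FreeGroup.lift_apply_of, MulOpposite.unop_inv]
    rw [Equiv.Perm.inv_eq_iff_eq]
    exact (V.act_act_not p x false).symm
  · simp [letterVal, genPerm]
  · simp [letterVal, genPerm]

theorem lift_genPerm_word (w : List ((X × Bool) ⊕ T)) (p : FreeGroup X × Option T) :
    (FreeGroup.lift V.genPerm (w.map letterVal).prod).unop p = w.foldl V.act p := by
  induction w generalizing p with
  | nil => simp
  | cons a w ih => simp [lift_genPerm_letterVal, ih]

theorem lift_genPerm_relators : ∀ g ∈ V.relators, FreeGroup.lift V.genPerm g = 1 := by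
  rintro _ ⟨r, a, rfl⟩
  rw [map_mul, map_inv, mul_inv_eq_one]
  apply MulOpposite.unop_injective
  ext1 p
  rw [V.lift_genPerm_word]
  have := V.foldl_act_eq_of_step (VFData.Step.rule [] [] r a) p
  simp only [List.nil_append, List.append_nil] at this
  rw [← this, ← V.lift_genPerm_word]
  simp

/-- The right action of the group on normal forms. -/
noncomputable def actHom : V.Grp →* (Equiv.Perm (FreeGroup X × Option T))ᵐᵒᵖ :=
  PresentedGroup.toGroup V.lift_genPerm_relators

/-- The normal form of an element of the group. -/
noncomputable def coord (g : V.Grp) : FreeGroup X × Option T :=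
  (V.actHom g).unop (1, none)

/-- The homomorphism from the free group on `X` to the group. -/
def ofFree : FreeGroup X →* V.Grp :=
  FreeGroup.lift fun x => PresentedGroup.of (Sum.inl x)

/-- The group element with a given normal form. -/
def elt (p : FreeGroup X × Option T) : V.Grp :=
  V.ofFree p.1 * V.genVal (Sum.inr p.2)

/-- The value in the group of a letter. -/
def letterGrp (a : (X × Bool) ⊕ T) : V.Grp := PresentedGroup.mk V.relators (letterVal a)

theorem ofFree_mk (L : List (X × Bool)) :
    V.ofFree (FreeGroup.mk L) = (L.map fun y => V.letterGrp (Sum.inl y)).prod := by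
  rw [ofFree, FreeGroup.lift_mk]
  congr 2
  ext ⟨x, b⟩
  cases b <;> simp [letterGrp, letterVal, PresentedGroup.of]

theorem elt_act (p : FreeGroup X × Option T) (a : (X × Bool) ⊕ T) :
    V.elt (V.act p a) = V.elt p * V.letterGrp a := by
  rcases p with ⟨u, _ | r⟩
  · rcases a with y | t
    · simp [VFData.act, elt, genVal, ofFree_mk]
    · simp [VFData.act, elt, genVal, letterGrp, letterVal, PresentedGroup.of]
  · have h : PresentedGroup.mk V.relators (letterVal (Sum.inr r) * letterVal a) =
        PresentedGroup.mk V.relators ((V.rhs r a).map letterVal).prod := by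
      rw [← mul_inv_eq_one, ← map_inv, ← map_mul]
      exact PresentedGroup.one_of_mem ⟨r, a, rfl⟩
    have h2 : V.genVal (Sum.inr (some r)) = PresentedGroup.mk V.relators (letterVal (Sum.inr r)) :=
      rfl
    simp only [VFData.act, elt, map_mul, letterGrp, h2, mul_assoc] at h ⊢
    rw [h, VFData.rhs, List.map_append, List.prod_append, map_mul, ofFree_mk]
    congr 2
    · rw [map_list_prod, List.map_map, List.map_map]
      rfl
    · cases V.rep r a <;> simp [genVal, letterVal, PresentedGroup.of]

theorem unop_actHom_letterGrp (a : (X × Bool) ⊕ T) (p : FreeGroup X × Option T) :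
    (V.actHom (V.letterGrp a)).unop p = V.act p a :=
  V.lift_genPerm_letterVal a p

theorem coord_mul_letterGrp (g : V.Grp) (a : (X × Bool) ⊕ T) :
    V.coord (g * V.letterGrp a) = V.act (V.coord g) a := by
  simp [coord, unop_actHom_letterGrp]

/-- The elements $g$ with this property form a subgroup, which contains the generators by `elt_act`.
Applied to the normal form of $1$, it shows that `coord` has `elt` as a left inverse. -/
theorem elt_unop_actHom (g : V.Grp) (p : FreeGroup X × Option T) :
    V.elt ((V.actHom g).unop p) = V.elt p * g := by
  let H : Subgroup V.Grp :=
    { carrier := {g | ∀ p, V.elt ((V.actHom g).unop p) = V.elt p * g}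
      one_mem' := by simp
      mul_mem' := fun {a b} ha hb p => by
        simp only [Set.mem_ofPred_eq] at ha hb
        simp [ha, hb, mul_assoc]
      inv_mem' := fun {a} ha p => by
        simp only [Set.mem_ofPred_eq] at ha
        rw [eq_mul_inv_iff_mul_eq, ← ha]
        simp }
  suffices h : ∀ g, g ∈ H from h g p
  have hle : Subgroup.closure (Set.range (PresentedGroup.of (rels := V.relators))) ≤ H := by
    rw [Subgroup.closure_le]
    rintro _ ⟨x | t, rfl⟩ p
    · have h : PresentedGroup.of (rels := V.relators) (Sum.inl x) =
          V.letterGrp (Sum.inl (x, true)) := rfl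
      rw [h, unop_actHom_letterGrp, elt_act]
    · have h : PresentedGroup.of (rels := V.relators) (Sum.inr t) = V.letterGrp (Sum.inr t) := rfl
      rw [h, unop_actHom_letterGrp, elt_act]
  intro g
  apply hle
  rw [PresentedGroup.closure_range_of]
  trivial

theorem elt_coord (g : V.Grp) : V.elt (V.coord g) = g := by
  rw [coord, elt_unop_actHom]
  simp [elt, genVal]

theorem coord_injective : Function.Injective V.coord :=
  Function.LeftInverse.injective V.elt_coord

theorem coord_ofFree (u : FreeGroup X) : V.coord (V.ofFree u) = (u, none) := by
  obtain ⟨L, rfl⟩ := Quot.exists_rep u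
  change V.coord (V.ofFree (FreeGroup.mk L)) = (FreeGroup.mk L, none)
  induction L using List.reverseRecOn with
  | nil => simp [← FreeGroup.one_eq_mk, coord]
  | append_singleton L y ih =>
    rw [← FreeGroup.mul_mk, map_mul, V.ofFree_mk [y]]
    simp [coord_mul_letterGrp, ih, VFData.act]

/-- The word by which the first coordinate changes under multiplication with a generator. -/
def shift (s : Option T) (z : X ⊕ Option T) : List (X × Bool) :=
  V.table s (z.map (fun x => (x, true)) id)

theorem coord_mul_genVal (g : V.Grp) (z : X ⊕ Option T) :
    (V.coord (g * V.genVal z)).1 =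
      (V.coord g).1 * FreeGroup.mk (V.shift (V.coord g).2 z) := by
  have key (a : (X × Bool) ⊕ T) (p : FreeGroup X × Option T) : (V.act p a).1 =
      p.1 * FreeGroup.mk (V.table p.2 (a.map id some)) := by
    rcases p with ⟨u, _ | r⟩ <;> rcases a with y | t <;>
      simp [VFData.act, table, ← FreeGroup.one_eq_mk]
  rcases z with x | _ | t
  · have h : V.genVal (Sum.inl x) = V.letterGrp (Sum.inl (x, true)) := rfl
    rw [h, coord_mul_letterGrp, key]
    rfl
  · have h : V.table (V.coord g).2 (Sum.inr none) = [] := by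
      cases (V.coord g).2 <;> rfl
    simp [genVal, shift, h, ← FreeGroup.one_eq_mk]
  · have h : V.genVal (Sum.inr (some t)) = V.letterGrp (Sum.inr t) := rfl
    rw [h, coord_mul_letterGrp, key]
    rfl

end VFPresentation

/-! # Rays, components and cuts -/

namespace InvGraph

open Filter

variable {V : Type u} {E : Type v} (Γ : InvGraph V E)

theorem tgt_inv (e : E) : Γ.tgt (Γ.inv e) = Γ.src e := by
  rw [← Γ.src_inv, Γ.inv_inv]

/-- Adjacency inside a set of vertices. -/
def AdjOn (A : Set V) (a b : V) : Prop :=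
  a ∈ A ∧ b ∈ A ∧ ∃ e : E, Γ.src e = a ∧ Γ.tgt e = b

variable {Γ}

theorem AdjOn.symm {A : Set V} {a b : V} (h : Γ.AdjOn A a b) : Γ.AdjOn A b a := by
  obtain ⟨ha, hb, e, rfl, rfl⟩ := h
  exact ⟨hb, ha, Γ.inv e, Γ.src_inv e, Γ.tgt_inv e⟩

theorem connectedOn_of_forall {A : Set V} (a : V)
    (h : ∀ v ∈ A, Relation.ReflTransGen (Γ.AdjOn A) v a) : Γ.ConnectedOn A := by
  intro u hu w hw
  have hs : Std.Symm (Γ.AdjOn A) := ⟨fun _ _ h => h.symm⟩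
  exact (h u hu).trans (Std.Symm.symm _ _ (h w hw))

variable (Γ)

/-- The connected component of `a` in the subgraph induced by `A`. -/
def component (A : Set V) (a : V) : Set V :=
  {v | Relation.ReflTransGen (Γ.AdjOn A) v a}

variable {Γ}

theorem component_subset {A : Set V} {a : V} (ha : a ∈ A) : Γ.component A a ⊆ A := by
  intro v hv
  rcases Relation.ReflTransGen.cases_head hv with rfl | ⟨c, h, -⟩
  · exact ha
  · exact h.1

theorem connectedOn_component (A : Set V) (a : V) : Γ.ConnectedOn (Γ.component A a) := by
  refine connectedOn_of_forall a fun v hv => ?_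
  induction hv using Relation.ReflTransGen.head_induction_on with
  | refl => exact .refl
  | head h h' ih => exact .head ⟨.head h h', h', h.2.2⟩ ih

/-- A sequence of pairwise distinct, consecutively adjacent vertices. -/
structure IsRay (Γ : InvGraph V E) (β : ℕ → V) : Prop where
  injective : Function.Injective β
  exists_edge : ∀ n, ∃ e : E, Γ.src e = β n ∧ Γ.tgt e = β (n + 1)

theorem exists_finite_forall_mem_iff {A : Set V} (hA : (Γ.dirBoundary A).Finite) :
    ∃ B : Set V, B.Finite ∧ ∀ e, Γ.src e ∉ B → (Γ.src e ∈ A ↔ Γ.tgt e ∈ A) := by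
  refine ⟨Γ.src '' Γ.dirBoundary A ∪ Γ.tgt '' Γ.dirBoundary A, (hA.image _).union (hA.image _),
    fun e he => ⟨fun h => ?_, fun h => ?_⟩⟩
  · by_contra h'
    exact he (.inl ⟨e, ⟨h, h'⟩, rfl⟩)
  · by_contra h'
    exact he (.inr ⟨Γ.inv e, ⟨by rwa [Γ.src_inv], by rwa [Γ.tgt_inv]⟩, Γ.tgt_inv e⟩)

theorem IsRay.eventually_notMem {β : ℕ → V} (hβ : Γ.IsRay β) {B : Set V} (hB : B.Finite) :
    ∀ᶠ n in atTop, β n ∉ B := by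
  rw [← Nat.cofinite_eq_atTop]
  exact hβ.injective.tendsto_cofinite hB.compl_mem_cofinite

/-- Being injective, a ray finally avoids the finitely many ends of boundary edges, and from then on
it cannot change sides. -/
theorem IsRay.eventually_mem_or_eventually_notMem {β : ℕ → V} (hβ : Γ.IsRay β) {A : Set V}
    (hA : (Γ.dirBoundary A).Finite) : (∀ᶠ n in atTop, β n ∈ A) ∨ ∀ᶠ n in atTop, β n ∉ A := by
  obtain ⟨B, hB, h⟩ := exists_finite_forall_mem_iff hA
  obtain ⟨N, hN⟩ := eventually_atTop.1 (hβ.eventually_notMem hB)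
  have key : ∀ n ≥ N, (β n ∈ A ↔ β N ∈ A) := by
    intro n hn
    induction n, hn using Nat.le_induction with
    | base => rfl
    | succ n hn ih =>
      obtain ⟨e, h1, h2⟩ := hβ.exists_edge n
      have := h e (by rw [h1]; exact hN n hn)
      rw [h1, h2] at this
      rw [← this, ih]
  by_cases hN' : β N ∈ A
  · exact .inl (eventually_atTop.2 ⟨N, fun n hn => (key n hn).2 hN'⟩)
  · exact .inr (eventually_atTop.2 ⟨N, fun n hn => (key n hn).not.2 hN'⟩)

theorem IsRay.mem_component {β : ℕ → V} (hβ : Γ.IsRay β) {A : Set V} {N : ℕ}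
    (hN : ∀ n ≥ N, β n ∈ A) : ∀ n ≥ N, β n ∈ Γ.component A (β N) := by
  intro n hn
  induction n, hn using Nat.le_induction with
  | base => exact .refl
  | succ n hn ih =>
    exact .head (AdjOn.symm ⟨hN n hn, hN _ (by omega), hβ.exists_edge n⟩) ih

/-- Two rays separated by a vertex set with finite boundary are separated by a cut of at most the
same weight. -/
theorem exists_isCut_weight_le (hΓ : Γ.ConnectedOn Set.univ) {A : Set V}
    (hA : (Γ.dirBoundary A).Finite) {β γ : ℕ → V} (hβ : Γ.IsRay β) (hγ : Γ.IsRay γ)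
    (hβA : ∀ᶠ n in atTop, β n ∈ A) (hγA : ∀ᶠ n in atTop, γ n ∉ A) :
    ∃ D : Set V, Γ.IsCut D ∧ Γ.weight D ≤ Γ.weight A ∧ (∀ᶠ n in atTop, β n ∈ D) ∧
      ∀ᶠ n in atTop, γ n ∉ D := by
  obtain ⟨N, hN⟩ := eventually_atTop.1 hβA
  obtain ⟨M, hM⟩ := eventually_atTop.1 hγA
  -- Passing to $P$ makes the $\beta$ side connected. Taking then the component $Q$ of the
  -- complement of $P$ that contains the tail of $\gamma$, and putting all the rest on the $\beta$
  -- side, makes both sides connected.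
  set P := Γ.component A (β N)
  have hPA : P ⊆ A := component_subset (hN N le_rfl)
  set Q := Γ.component Pᶜ (γ M)
  have hM' : ∀ n ≥ M, γ n ∈ Pᶜ := fun n hn h => hM n hn (hPA h)
  have hQP : Q ⊆ Pᶜ := component_subset (hM' M le_rfl)
  have hβP := hβ.mem_component hN
  have hγQ := hγ.mem_component hM'
  -- A neighbour of $Q$ outside $Q$ must lie in $P$, and a neighbour of $P$ outside $P$ must lie
  -- outside $A$, both by maximality of components.
  have hsub : Γ.dirBoundary Qᶜ ⊆ Γ.dirBoundary A := by
    rintro e ⟨h1, h2⟩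
    rw [compl_compl] at h2
    have h3 : Γ.src e ∈ P := by
      by_contra h
      exact h1 (.head ⟨h, hQP h2, e, rfl, rfl⟩ h2)
    refine ⟨hPA h3, fun h => hQP h2 ?_⟩
    exact .head (AdjOn.symm ⟨hPA h3, h, e, rfl, rfl⟩) h3
  refine ⟨Qᶜ, ⟨⟨β N, fun h => hQP h (hβP N le_rfl)⟩, ⟨γ M, by simpa using hγQ M le_rfl⟩, ?_, ?_,
    hA.subset hsub⟩, Set.ncard_le_ncard hsub hA,
    eventually_atTop.2 ⟨N, fun n hn h => hQP h (hβP n hn)⟩,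
    eventually_atTop.2 ⟨M, fun n hn => by simpa using hγQ n hn⟩⟩
  -- Follow a path of $\Gamma$ towards `β N`. Until it meets $P$ it cannot enter $Q$, and inside $P$
  -- one can continue within $P$.
  · refine connectedOn_of_forall (β N) fun v hv => ?_
    have hpath := hΓ (Set.mem_univ v) (Set.mem_univ (β N))
    induction hpath using Relation.ReflTransGen.head_induction_on with
    | refl => exact .refl
    | @head v c h h' ih =>
      by_cases hvP : v ∈ P
      · refine Relation.ReflTransGen.mono ?_ _ _
          (connectedOn_component A (β N) hvP (hβP N le_rfl))
        exact fun a b h => ⟨fun h' => hQP h' h.1, fun h' => hQP h' h.2.1, h.2.2⟩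
      · have hc : c ∈ Qᶜ := fun hc => hv (.head ⟨hvP, hQP hc, h.2.2⟩ hc)
        exact .head ⟨hv, hc, h.2.2⟩ (ih hc)
  · rw [compl_compl]
    exact connectedOn_component _ _

/-! ### The two ends of a bi-infinite simple path -/

namespace BiInfSimplePath

variable (α : Γ.BiInfSimplePath)

theorem isRay_natCast : Γ.IsRay fun n : ℕ => α.vert n where
  injective _ _ h := by simpa using α.simple h
  exists_edge n := ⟨α.edge (n + 1), by simp [α.src_edge], by simp [α.tgt_edge]⟩

theorem isRay_neg_natCast : Γ.IsRay fun n : ℕ => α.vert (-n) where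
  injective _ _ h := by simpa using α.simple h
  exists_edge n := ⟨Γ.inv (α.edge (-n)), by simp [Γ.src_inv, α.tgt_edge], by
    rw [Γ.tgt_inv, α.src_edge]; congr 1; push_cast; ring⟩

variable {α}

theorem infinite_range_inter {β : ℕ → V} (hβ : Γ.IsRay β) (hr : Set.range β ⊆ Set.range α.vert)
    {A : Set V} (hA : ∀ᶠ n in atTop, β n ∈ A) : (Set.range α.vert ∩ A).Infinite := by
  obtain ⟨N, hN⟩ := eventually_atTop.1 hA
  refine Set.Infinite.mono ?_ ((Set.Ici_infinite N).image hβ.injective.injOn)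
  rintro _ ⟨n, hn, rfl⟩
  exact ⟨hr ⟨n, rfl⟩, hN n hn⟩

theorem finite_range_inter {A : Set V} (h1 : ∀ᶠ n : ℕ in atTop, α.vert n ∉ A)
    (h2 : ∀ᶠ n : ℕ in atTop, α.vert (-n) ∉ A) : (Set.range α.vert ∩ A).Finite := by
  obtain ⟨N, hN⟩ := eventually_atTop.1 (h1.and h2)
  refine ((Set.finite_Ioo (-(N : ℤ)) N).image α.vert).subset ?_
  rintro _ ⟨⟨k, rfl⟩, hk⟩
  refine ⟨k, ⟨?_, ?_⟩, rfl⟩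
  · by_contra h
    refine (hN k.natAbs (by omega)).2 ?_
    rwa [show -(k.natAbs : ℤ) = k by omega]
  · by_contra h
    refine (hN k.natAbs (by omega)).1 ?_
    rwa [show (k.natAbs : ℤ) = k by omega]

/-- Each half of the path finally stays on one side. If both halves chose the same side, only
finitely many vertices would lie on the other. -/
theorem SplitBy.eventually {C : Set V} (h : α.SplitBy C) :
    ((∀ᶠ n : ℕ in atTop, α.vert n ∈ C) ∧ ∀ᶠ n : ℕ in atTop, α.vert (-n) ∉ C) ∨
      ((∀ᶠ n : ℕ in atTop, α.vert n ∉ C) ∧ ∀ᶠ n : ℕ in atTop, α.vert (-n) ∈ C) := by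
  obtain ⟨hC, h1, h2⟩ := h
  rcases α.isRay_natCast.eventually_mem_or_eventually_notMem hC.finite_boundary with hp | hp <;>
  rcases α.isRay_neg_natCast.eventually_mem_or_eventually_notMem hC.finite_boundary with hn | hn
  · exact absurd (finite_range_inter (by simpa using hp) (by simpa using hn)) h2
  · exact .inl ⟨hp, hn⟩
  · exact .inr ⟨hp, hn⟩
  · exact absurd (finite_range_inter hp hn) h1

end BiInfSimplePath

end InvGraph

/-! # Cones in free groups -/

namespace FreeGroup

variable {X : Type u} [DecidableEq X]

/-- The elements of the free group whose reduced word starts with that of `w`. -/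
def cone (w : FreeGroup X) : Set (FreeGroup X) :=
  {v | w.toWord <+: v.toWord}

theorem toWord_mul_mk_singleton (v : FreeGroup X) (y : X × Bool) :
    (v * mk [y]).toWord = v.toWord ++ [y] ∨
      v.toWord = (v * mk [y]).toWord ++ [(y.1, !y.2)] := by
  by_cases h : IsReduced (v.toWord ++ [y])
  · left
    rw [toWord_mul, toWord_mk, reduce_singleton, h.reduce_eq]
  · right
    have hv := isReduced_toWord (x := v)
    have hmk := mk_toWord (x := v)
    generalize v.toWord = l at h hv hmk
    subst hmk
    rcases List.eq_nil_or_concat l with rfl | ⟨L, ⟨x, b⟩, rfl⟩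
    · simp at h
    · rw [List.concat_eq_append] at *
      obtain ⟨x', b'⟩ := y
      have h' : x = x' ∧ b ≠ b' := by
        rw [IsReduced, List.isChain_append] at h
        by_contra hc
        refine h ⟨hv, List.isChain_singleton _, ?_⟩
        simp only [List.getLast?_concat, List.head?_cons, Option.mem_some_iff]
        rintro _ rfl _ rfl hx
        by_contra hb
        exact hc ⟨hx, hb⟩
      obtain ⟨rfl, hb⟩ := h'
      obtain rfl : b' = !b := by cases b <;> cases b' <;> simp_all
      have hL : IsReduced L := hv.infix ⟨[], [(x, b)], by simp⟩
      have : mk (L ++ [(x, b)]) * mk [(x, !b)] = mk L := by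
        rw [mul_mk, List.append_assoc]
        have h := Red.Step.not (L₁ := L) (L₂ := []) (x := x) (b := b)
        rw [List.append_nil] at h
        exact Quot.sound h
      rw [this, toWord_mk, hL.reduce_eq]
      simp

theorem eq_of_mem_cone_of_notMem {w v : FreeGroup X} {y : X × Bool} (h : v ∈ cone w)
    (h' : v * mk [y] ∉ cone w) : v = w := by
  rcases toWord_mul_mk_singleton v y with h1 | h1
  · exact absurd (h.trans ⟨[y], h1.symm⟩) h'
  · simp only [cone, Set.mem_ofPred_eq] at h h'
    rw [h1, List.prefix_concat_iff] at h
    rcases h with h | h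
    · rw [← h1] at h
      exact (toWord_injective h).symm
    · exact absurd h h'

theorem eq_of_notMem_cone_of_mem {w v : FreeGroup X} {y : X × Bool} (h : v ∉ cone w)
    (h' : v * mk [y] ∈ cone w) : v * mk [y] = w := by
  refine eq_of_mem_cone_of_notMem (y := (y.1, !y.2)) h' ?_
  have : mk [y] * mk [(y.1, !y.2)] = 1 := by
    rw [mul_mk, one_eq_mk]
    exact Quot.sound (Red.Step.not (L₁ := []) (L₂ := []) (x := y.1) (b := y.2))
  rwa [mul_assoc, this, mul_one]

/-- Reading $L$ from $v$ is a walk in the tree of the free group, where the cone is the subtree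
hanging at $w$. The walk changes sides only by a step that has $w$ as its end inside the cone. -/
theorem exists_take_of_crossing {w v : FreeGroup X} {L : List (X × Bool)}
    (h : ¬ (v ∈ cone w ↔ v * mk L ∈ cone w)) : ∃ i ≤ L.length, v * mk (L.take i) = w := by
  induction L using List.reverseRecOn with
  | nil => simp [← one_eq_mk] at h
  | append_singleton L y ih =>
    by_cases hL : v ∈ cone w ↔ v * mk L ∈ cone w
    · rw [hL, ← mul_mk, ← mul_assoc] at h
      by_cases hm : v * mk L ∈ cone w
      · refine ⟨L.length, by simp, ?_⟩
        rw [List.take_left]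
        exact eq_of_mem_cone_of_notMem (y := y) hm (by tauto)
      · refine ⟨(L ++ [y]).length, le_rfl, ?_⟩
        rw [List.take_length, ← mul_mk, ← mul_assoc]
        exact eq_of_notMem_cone_of_mem hm (by tauto)
    · obtain ⟨i, hi, h⟩ := ih hL
      exact ⟨i, by simp; omega, by rw [List.take_append_of_le_length hi, h]⟩

theorem eq_of_mem_cone {w w' v : FreeGroup X} (h : v ∈ cone w) (h' : v ∈ cone w')
    (hn : w.norm = w'.norm) : w = w' :=
  toWord_injective ((List.prefix_of_prefix_length_le h h' hn.le).eq_of_length hn)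

theorem exists_mem_cone {v : FreeGroup X} {n : ℕ} (h : n ≤ v.norm) :
    ∃ w : FreeGroup X, w.norm = n ∧ v ∈ cone w := by
  have hr : IsReduced (v.toWord.take n) :=
    isReduced_toWord.infix (List.take_prefix _ _).isInfix
  refine ⟨mk (v.toWord.take n), ?_, ?_⟩
  · rw [norm, toWord_mk, hr.reduce_eq, List.length_take]
    exact min_eq_left h
  · rw [cone, Set.mem_ofPred_eq, toWord_mk, hr.reduce_eq]
    exact List.take_prefix _ _

theorem finite_norm_le [Finite X] (n : ℕ) : {v : FreeGroup X | v.norm ≤ n}.Finite :=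
  (List.finite_length_le (X × Bool) n).preimage toWord_injective.injOn

theorem norm_le_norm_mul_mk_add (u : FreeGroup X) (L : List (X × Bool)) :
    u.norm ≤ (u * mk L).norm + L.length := by
  have h := norm_mul_le (u * mk L) (mk L)⁻¹
  rw [mul_inv_cancel_right, norm_inv_eq] at h
  exact h.trans (Nat.add_le_add_left norm_mk_le _)

end FreeGroup

/-! # Cones in the Cayley graph -/

namespace VFPresentation

open Filter

variable {X : Type u} {T : Type v} (V : VFPresentation X T)

theorem cayleyGraph_connectedOn_univ : V.cayleyGraph.ConnectedOn Set.univ := by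
  refine InvGraph.connectedOn_of_forall 1 fun v _ => ?_
  have hs : Std.Symm (V.cayleyGraph.AdjOn Set.univ) := ⟨fun _ _ h => h.symm⟩
  let H : Subgroup V.Grp :=
    { carrier := {g | ∀ h, Relation.ReflTransGen (V.cayleyGraph.AdjOn Set.univ) (h * g) h}
      one_mem' := fun h => by simpa using Relation.ReflTransGen.refl
      mul_mem' := fun {a b} ha hb h => by
        rw [← mul_assoc]
        exact (hb (h * a)).trans (ha h)
      inv_mem' := fun {a} ha h => by
        have := ha (h * a⁻¹)
        rw [inv_mul_cancel_right] at this
        exact Std.Symm.symm _ _ this }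
  have hle : Subgroup.closure (Set.range (PresentedGroup.of (rels := V.relators))) ≤ H := by
    rw [Subgroup.closure_le]
    rintro _ ⟨x | t, rfl⟩ h
    · exact .single (InvGraph.AdjOn.symm
        ⟨trivial, trivial, (h, (Sum.inl x, true)), rfl, rfl⟩)
    · exact .single (InvGraph.AdjOn.symm
        ⟨trivial, trivial, (h, (Sum.inr (some t), true)), rfl, rfl⟩)
  have : v ∈ H := hle (by rw [PresentedGroup.closure_range_of]; trivial)
  simpa using this 1

/-- The end of an edge from which it is labelled by a generator, not by a formal inverse. -/
def base (e : V.Grp × ((X ⊕ Option T) × Bool)) : V.Grp :=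
  e.1 * cond e.2.2 1 (V.genVal e.2.1)⁻¹

theorem base_eq (e : V.Grp × ((X ⊕ Option T) × Bool)) :
    (V.cayleyGraph.src e = V.base e ∧ V.cayleyGraph.tgt e = V.base e * V.genVal e.2.1) ∨
      (V.cayleyGraph.tgt e = V.base e ∧ V.cayleyGraph.src e = V.base e * V.genVal e.2.1) := by
  obtain ⟨g, z, _ | _⟩ := e <;> simp [base, cayleyGraph, cayleyInvGraph]

/-- The maximum of `|x_{r, a}| + 1`. -/
def maxLength [Fintype X] [Fintype T] : ℕ :=
  Finset.univ.sup fun p : Option T × ((X × Bool) ⊕ Option T) => (V.table p.1 p.2).length + 1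

theorem length_shift_lt [Fintype X] [Fintype T] (s : Option T) (z : X ⊕ Option T) :
    (V.shift s z).length < V.maxLength :=
  Finset.le_sup (f := fun p : Option T × ((X × Bool) ⊕ Option T) => (V.table p.1 p.2).length + 1)
    (Finset.mem_univ (s, _))

/-! ### Cones have small boundary and capture rays -/

section Cone

variable [DecidableEq X]

/-- The group elements whose normal form starts with `w`. -/
def grpCone (w : FreeGroup X) : Set V.Grp :=
  {g | (V.coord g).1 ∈ FreeGroup.cone w}

/-- The words $x_{r,a}$ describe multiplication by generators, so the edge is read from `base e`,
whichever end that is. The crossing is then one in the free group, along the word `shift`. -/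
theorem exists_take_of_crossing {w : FreeGroup X} {e : V.Grp × ((X ⊕ Option T) × Bool)}
    (h : ¬ (V.cayleyGraph.src e ∈ V.grpCone w ↔ V.cayleyGraph.tgt e ∈ V.grpCone w)) :
    ∃ i ≤ (V.shift (V.coord (V.base e)).2 e.2.1).length,
      (V.coord (V.base e)).1 *
        FreeGroup.mk ((V.shift (V.coord (V.base e)).2 e.2.1).take i) = w := by
  apply FreeGroup.exists_take_of_crossing
  rw [← coord_mul_genVal]
  change ¬ (V.base e ∈ V.grpCone w ↔ V.base e * V.genVal e.2.1 ∈ V.grpCone w)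
  rcases V.base_eq e with ⟨h1, h2⟩ | ⟨h1, h2⟩ <;> rw [h1, h2] at h
  · exact h
  · rwa [iff_comm] at h

/-- Join $g=us$ to $u$ by an edge labelled $s$, and $u$ to $w$ by the path reading $L$. With $R$
bounding the free parts of all ends of boundary edges of $C$, this walk stays too far out to change
sides. One $|L|$ in the bound pays for $|u|\ge|w|-|L|$, the other for the norm lost along the path.
-/
theorem near_ofFree {C : Set V.Grp} (hC : (V.cayleyGraph.dirBoundary C).Finite) :
    ∃ R : ℕ, ∀ (g : V.Grp) (L : List (X × Bool)) (w : FreeGroup X),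
      (V.coord g).1 * FreeGroup.mk L = w → R + 2 * L.length < w.norm →
        (g ∈ C ↔ V.ofFree w ∈ C) := by
  obtain ⟨B, hB, hBC⟩ := InvGraph.exists_finite_forall_mem_iff hC
  obtain ⟨R, hR⟩ := (hB.image fun g => (V.coord g).1.norm).bddAbove
  have hedge (u : FreeGroup X) (hu : R < u.norm) (a : (X ⊕ Option T) × Bool) :
      V.ofFree u ∈ C ↔ V.cayleyGraph.tgt (V.ofFree u, a) ∈ C := by
    refine hBC (V.ofFree u, a) fun h => hu.not_ge ?_
    have := hR ⟨_, h, rfl⟩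
    simpa [cayleyGraph, cayleyInvGraph, coord_ofFree] using this
  have hpath (L : List (X × Bool)) (u : FreeGroup X) (hu : R + L.length < u.norm) :
      V.ofFree u ∈ C ↔ V.ofFree (u * FreeGroup.mk L) ∈ C := by
    induction L generalizing u with
    | nil => simp [← FreeGroup.one_eq_mk]
    | cons y L ih =>
      rw [List.length_cons] at hu
      have h1 := FreeGroup.norm_le_norm_mul_mk_add u [y]
      rw [List.length_singleton] at h1
      have h2 := ih (u * FreeGroup.mk [y]) (by omega)
      rw [mul_assoc, FreeGroup.mul_mk, List.singleton_append] at h2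
      rw [← h2, hedge u (by omega) (Sum.inl y.1, y.2), map_mul, ofFree_mk]
      obtain ⟨x, _ | _⟩ := y <;>
        simp [cayleyGraph, cayleyInvGraph, letterGrp, letterVal, genVal, PresentedGroup.of]
  refine ⟨R, ?_⟩
  rintro g L w rfl hw
  have h1 := (FreeGroup.norm_mul_le (V.coord g).1 (FreeGroup.mk L)).trans
    (Nat.add_le_add_left FreeGroup.norm_mk_le _)
  rw [← hpath L _ (by omega), hedge _ (by omega) (Sum.inr (V.coord g).2, true)]
  conv_lhs => rw [← V.elt_coord g]
  rfl

variable [Fintype X] [Fintype T]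

/-- The edge crossing the boundary of the cone of `w` with given label and position. -/
def crossingEdge (w : FreeGroup X)
    (p : Option T × ((X ⊕ Option T) × Bool) × Fin V.maxLength) :
    V.Grp × ((X ⊕ Option T) × Bool) :=
  (V.elt (w * (FreeGroup.mk ((V.shift p.1 p.2.1.1).take p.2.2))⁻¹, p.1) *
    cond p.2.1.2 1 (V.genVal p.2.1.1), p.2.1)

/-- If the prefix of length $i$ carries the free part of `base e` to $w$, that free part is
recovered by dividing $w$ by the prefix. With the $S$-part and the label this recovers the edge. -/
theorem dirBoundary_grpCone_subset (w : FreeGroup X) :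
    V.cayleyGraph.dirBoundary (V.grpCone w) ⊆ Set.range (V.crossingEdge w) := by
  rintro e ⟨h1, h2⟩
  obtain ⟨i, hi, h⟩ := V.exists_take_of_crossing (w := w) (e := e) (fun h => h2 (h.1 h1))
  refine ⟨((V.coord (V.base e)).2, e.2, ⟨i, hi.trans_lt (V.length_shift_lt _ _)⟩), ?_⟩
  rw [crossingEdge, ← h, mul_inv_cancel_right, Prod.mk.eta, elt_coord]
  obtain ⟨g, z, _ | _⟩ := e <;> simp [base]

theorem finite_dirBoundary_grpCone (w : FreeGroup X) :
    (V.cayleyGraph.dirBoundary (V.grpCone w)).Finite :=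
  (Set.finite_range _).subset (V.dirBoundary_grpCone_subset w)

theorem weight_grpCone_le (w : FreeGroup X) : V.cayleyGraph.weight (V.grpCone w) ≤ V.size := by
  calc V.cayleyGraph.weight (V.grpCone w)
      ≤ (Set.range (V.crossingEdge w)).ncard :=
        Set.ncard_le_ncard (V.dirBoundary_grpCone_subset w) (Set.finite_range _)
    _ ≤ (Set.univ : Set (Option T × ((X ⊕ Option T) × Bool) × Fin V.maxLength)).ncard := by
        rw [← Set.image_univ]
        exact Set.ncard_image_le Set.finite_univ
    _ = V.size := by
        rw [Set.ncard_univ, Nat.card_eq_fintype_card]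
        simp only [Fintype.card_prod, Fintype.card_sum, Fintype.card_bool, Fintype.card_fin]
        rw [size, ← maxLength]
        ring

/-- There are finitely many words of length $n$, so otherwise the ray would finally avoid all their
cones. But only finitely many elements have free part of length at most $n$, so the ray must visit
some cone again. -/
theorem exists_eventually_mem_grpCone {β : ℕ → V.Grp} (hβ : V.cayleyGraph.IsRay β) (n : ℕ) :
    ∃ w : FreeGroup X, w.norm = n ∧ ∀ᶠ k in atTop, β k ∈ V.grpCone w := by
  by_contra! hc
  have h1 : ∀ᶠ k in atTop, ∀ w ∈ {w : FreeGroup X | w.norm = n}, β k ∉ V.grpCone w := by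
    refine (eventually_all_finite ((FreeGroup.finite_norm_le n).subset
      fun w (hw : w.norm = n) => hw.le)).2 fun w hw => ?_
    refine (hβ.eventually_mem_or_eventually_notMem (V.finite_dirBoundary_grpCone w)).resolve_left ?_
    exact fun h => absurd h (Filter.not_eventually.2 (hc w hw))
  have hfin : {g : V.Grp | (V.coord g).1.norm ≤ n}.Finite := by
    refine (((FreeGroup.finite_norm_le n).prod (Set.finite_univ (α := Option T))).preimage
      V.coord_injective.injOn).subset fun g hg => ?_
    simpa using hg
  obtain ⟨k, h2, h3⟩ := (h1.and (hβ.eventually_notMem hfin)).exists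
  obtain ⟨w, hw, hk⟩ := FreeGroup.exists_mem_cone (not_le.1 h3).le
  exact h2 w hw hk

/-- The free part of `β N` is too short to lie in the cone, so the ray enters it later. The entering
edge has its base within `maxLength` of $w$. -/
theorem exists_near_of_eventually_mem {β : ℕ → V.Grp} (hβ : V.cayleyGraph.IsRay β)
    {w : FreeGroup X} (h : ∀ᶠ k in atTop, β k ∈ V.grpCone w) {N : ℕ}
    (hN : (V.coord (β N)).1.norm < w.norm) :
    ∃ n ≥ N, ∃ L : List (X × Bool), L.length ≤ V.maxLength ∧
      (V.coord (β n)).1 * FreeGroup.mk L = w := by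
  obtain ⟨n, hn, h1, h2⟩ : ∃ n ≥ N, β n ∉ V.grpCone w ∧ β (n + 1) ∈ V.grpCone w := by
    by_contra! hc
    have hall : ∀ n ≥ N, β n ∉ V.grpCone w := fun n hn => by
      induction n, hn using Nat.le_induction with
      | base => exact fun h => hN.not_ge (List.IsPrefix.length_le h)
      | succ n hn ih => exact hc n hn ih
    obtain ⟨n, h1, h2⟩ := (h.and (eventually_ge_atTop N)).exists
    exact hall n h2 h1
  obtain ⟨e, he1, he2⟩ := hβ.exists_edge n
  obtain ⟨i, -, hw⟩ := V.exists_take_of_crossing (w := w) (e := e) (by rw [he1, he2]; tauto)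
  have hlen := ((V.shift (V.coord (V.base e)).2 e.2.1).length_take_le' i).trans
    (V.length_shift_lt _ _).le
  -- The base may be the end before or after the crossing, so the vertex found is `β n` or `β (n +
  -- 1)`.
  rcases V.base_eq e with ⟨hb, -⟩ | ⟨hb, -⟩
  · exact ⟨n, hn, _, hlen, by rw [← he1, hb]; exact hw⟩
  · exact ⟨n + 1, by omega, _, hlen, by rw [← he2, hb]; exact hw⟩

end Cone

/-- Rays separated by a vertex set with finite boundary are separated by a cut of weight at most the
size of the presentation. -/
theorem exists_isCut_weight_le_size [Fintype X] [Fintype T] {C : Set V.Grp}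
    (hC : (V.cayleyGraph.dirBoundary C).Finite) {β γ : ℕ → V.Grp}
    (hβ : V.cayleyGraph.IsRay β) (hγ : V.cayleyGraph.IsRay γ)
    (hβC : ∀ᶠ n in atTop, β n ∈ C) (hγC : ∀ᶠ n in atTop, γ n ∉ C) :
    ∃ D : Set V.Grp, V.cayleyGraph.IsCut D ∧ V.cayleyGraph.weight D ≤ V.size ∧
      (∀ᶠ n in atTop, β n ∈ D) ∧ ∀ᶠ n in atTop, γ n ∉ D := by
  classical
  obtain ⟨R, hR⟩ := V.near_ofFree hC
  obtain ⟨N, hN⟩ := eventually_atTop.1 (hβC.and hγC)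
  -- The first two terms make `near_ofFree` applicable to words of length at most `maxLength`. The
  -- two norms ensure that `β N` and `γ N` lie outside every cone of level $n$, so that both rays
  -- enter their cones after time $N$, when their sides of $C$ are settled.
  set n := R + 2 * V.maxLength + (V.coord (β N)).1.norm + (V.coord (γ N)).1.norm + 1 with hn
  obtain ⟨w, hw, hβw⟩ := V.exists_eventually_mem_grpCone hβ n
  obtain ⟨w', hw', hγw⟩ := V.exists_eventually_mem_grpCone hγ n
  -- With a common $w$, the element `V.ofFree w` would be in $C$ because $\beta$ passes near it, and
  -- then $\gamma$ would visit $C$ after time $N$.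
  have hne : w ≠ w' := by
    rintro rfl
    obtain ⟨i, hi, L, hL, h⟩ := V.exists_near_of_eventually_mem hβ hβw (N := N) (by omega)
    obtain ⟨j, hj, L', hL', h'⟩ := V.exists_near_of_eventually_mem hγ hγw (N := N) (by omega)
    have h1 := (hR (β i) L w h (by omega)).1 (hN i hi).1
    exact (hN j hj).2 ((hR (γ j) L' w h' (by omega)).2 h1)
  obtain ⟨D, hD, hDw, h1, h2⟩ := InvGraph.exists_isCut_weight_le V.cayleyGraph_connectedOn_univ
    (V.finite_dirBoundary_grpCone w) hβ hγ hβw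
    (hγw.mono fun k hk h => hne (FreeGroup.eq_of_mem_cone h hk (hw.trans hw'.symm)))
  exact ⟨D, hD, hDw.trans (V.weight_grpCone_le w), h1, h2⟩

end VFPresentation

theorem mainTheorem10 {X : Type*} {T : Type*} [Fintype X] [Fintype T] (V : VFPresentation X T)
    (C : Set V.Grp) (hC : V.cayleyGraph.IsMinimalCut C) :
    V.cayleyGraph.IsKCut (V.size ^ 2) C := by
  obtain ⟨α, hα, hmin⟩ := hC
  have hp : Set.range (fun n : ℕ => α.vert n) ⊆ Set.range α.vert := by
    rintro _ ⟨n, rfl⟩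
    exact ⟨n, rfl⟩
  have hm : Set.range (fun n : ℕ => α.vert (-n)) ⊆ Set.range α.vert := by
    rintro _ ⟨n, rfl⟩
    exact ⟨-n, rfl⟩
  -- `exists_isCut_weight_le_size` puts its first ray inside $D$, so the half of $\alpha$ that stays
  -- in $C$ is passed first.
  obtain ⟨D, hD, hw⟩ : ∃ D, α.SplitBy D ∧ V.cayleyGraph.weight D ≤ V.size := by
    rcases hα.eventually with ⟨h1, h2⟩ | ⟨h1, h2⟩
    · obtain ⟨D, hD, hw, h3, h4⟩ := V.exists_isCut_weight_le_size hα.1.finite_boundary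
        α.isRay_natCast α.isRay_neg_natCast h1 h2
      exact ⟨D, ⟨hD, InvGraph.BiInfSimplePath.infinite_range_inter α.isRay_natCast hp h3,
        InvGraph.BiInfSimplePath.infinite_range_inter α.isRay_neg_natCast hm h4⟩, hw⟩
    · obtain ⟨D, hD, hw, h3, h4⟩ := V.exists_isCut_weight_le_size hα.1.finite_boundary
        α.isRay_neg_natCast α.isRay_natCast h2 h1
      exact ⟨D, ⟨hD, InvGraph.BiInfSimplePath.infinite_range_inter α.isRay_neg_natCast hm h3,
        InvGraph.BiInfSimplePath.infinite_range_inter α.isRay_natCast hp h4⟩, hw⟩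
  exact ⟨hα.1, (hmin D hD).trans (hw.trans (Nat.le_self_pow two_ne_zero _))⟩
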